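/- Let $N\ge 2$ and $c>0$. For a function $f$ of $r>0$ consider the vortex system $$\dot z_j=i f(|z_j|)z_j+ic\sum_{k\ne j}\frac{z_j-z_k}{|z_j-z_k|^2},\qquad z_j\in\mathbb C,\ j=1,\dots,N .$$ Let $R>0$, let $f$ be differentiable at $R$, and put $\omega=f(R)+\frac{c(N-1)}{2R^2}$. Then the ring $z_j(t)=e^{i\omega t}\xi_j$ with $\xi_j=Re^{2\pi i j/N}$ is a solution of the vortex system, and $\xi$ is an equilibrium of the aggregation system $\dot x_j=(f(|x_j|)-\omega)x_j+c\sum_{k\ne j}\frac{x_j-x_k}{|x_j-x_k|^2}$. The eigenvalues (with multiplicity) of the linearization of the aggregation system at $\xi$, a real-linear map on $\mathbb C^N\cong\mathbb R^{2N}$, are, for $m=0,\dots,N-1$, $$\lambda_+(m)=f'(R)R+\frac{c}{2R^2}\bigl[(m-1)(N-m-1)-(N-1)\bigr],\qquad \lambda_-(m)=\frac{c}{2R^2}\bigl[-(N-1)-(m-1)(N-m-1)\bigr].$$ Write $z_j=e^{i\omega t}x_j$, so that $\xi$ is an equilibrium of the vortex system in the variables $x$. Call the ring stable if all eigenvalues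 of the linearization at $\xi$ of the vortex system in these variables are purely imaginary (zero included) and the solutions of the linearized system stay bounded for $t\ge0$, by a constant times their initial size, modulo the direction $i\xi$ of infinitesimal rotations. Call it unstable if this linearization has an eigenvalue with positive real part. Set $$P=\begin{cases} f'(R)R+\dfrac{c}{8R^2}(N-1)(N-7), & N\text{ odd},\\[2mm] f'(R)R+\dfrac{c}{8R^2}(N^2-8N+8), & N\text{ even}.\end{cases}$$ Then the ring is stable if and only if $P<0$, and it is unstable if $P>0$. Consequently the ring is generically unstable if $N\ge7$ and $f$ is increasing: let $S\subseteq(0,\infty)$ be open and let $f$ be $C^1$ and strictly increasing on $S$. Then the ring of radius $R\in S$ is unstable whenever $N\ge8$ or $f'(R)>0$, and for every $N\ge7$ there is an open dense subset of $S$ such that the ring is unstable for every radius $R$ in it. -/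

import Mathlib

noncomputable section

/-- Velocity field of the `N`-vortex system
`dz_j/dt = i f(|z_j|) z_j + i c ∑_{k ≠ j} (z_j - z_k) / |z_j - z_k|²`. -/
def vortexField {N : ℕ} (f : ℝ → ℝ) (c : ℝ) (z : Fin N → ℂ) : Fin N → ℂ := fun j =>
  Complex.I * (f ‖z j‖ : ℂ) * z j +
    Complex.I * (c : ℂ) *
      ∑ k ∈ Finset.univ.erase j, (z j - z k) / ((‖z j - z k‖ ^ 2 : ℝ) : ℂ)

/-- The vortex system in the frame that rotates with angular velocity `ω`: `z_j = e^{iωt} x_j`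
solves the vortex system if and only if `x` solves `dx/dt = corotatingField f c ω x`. -/
def corotatingField {N : ℕ} (f : ℝ → ℝ) (c ω : ℝ) (x : Fin N → ℂ) : Fin N → ℂ := fun j =>
  vortexField f c x j - Complex.I * (ω : ℂ) * x j

/-- Velocity field of the aggregation system
`dx_j/dt = (f(|x_j|) - ω) x_j + c ∑_{k ≠ j} (x_j - x_k) / |x_j - x_k|²`. -/
def aggregationField {N : ℕ} (f : ℝ → ℝ) (c ω : ℝ) (x : Fin N → ℂ) : Fin N → ℂ := fun j =>
  ((f ‖x j‖ - ω : ℝ) : ℂ) * x j +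
    (c : ℂ) * ∑ k ∈ Finset.univ.erase j, (x j - x k) / ((‖x j - x k‖ ^ 2 : ℝ) : ℂ)

/-- The vertices of the regular `N`-gon of radius `R` centred at the origin. -/
def ringPolygon (N : ℕ) (R : ℝ) : Fin N → ℂ := fun j =>
  (R : ℂ) * Complex.exp (2 * (Real.pi : ℂ) * Complex.I / (N : ℂ) * ((j : ℕ) : ℂ))

/-- The polygon rotating rigidly with angular velocity `ω`. -/
def ringSolution (N : ℕ) (R ω : ℝ) (t : ℝ) : Fin N → ℂ := fun j =>
  Complex.exp (Complex.I * (ω : ℂ) * (t : ℂ)) * ringPolygon N R j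

/-- The angular velocity of the ring: `ω = f(R) + c (N - 1) / (2 R²)`. -/
def ringFrequency (N : ℕ) (f : ℝ → ℝ) (c R : ℝ) : ℝ :=
  f R + c * ((N : ℝ) - 1) / (2 * R ^ 2)

/-- `λ₊(m) = f'(R) R + c / (2 R²) [(m - 1)(N - m - 1) - (N - 1)]`. -/
def lambdaPlus (N : ℕ) (f : ℝ → ℝ) (c R : ℝ) (m : ℕ) : ℝ :=
  deriv f R * R +
    c / (2 * R ^ 2) * (((m : ℝ) - 1) * ((N : ℝ) - (m : ℝ) - 1) - ((N : ℝ) - 1))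

/-- `λ₋(m) = c / (2 R²) [-(N - 1) - (m - 1)(N - m - 1)]`. -/
def lambdaMinus (N : ℕ) (c R : ℝ) (m : ℕ) : ℝ :=
  c / (2 * R ^ 2) * (-((N : ℝ) - 1) - ((m : ℝ) - 1) * ((N : ℝ) - (m : ℝ) - 1))

/-- `μ` is an eigenvalue of (the complexification of) the real-linear map `L`. -/
def IsComplexEigenvalue {E : Type*} [NormedAddCommGroup E] [NormedSpace ℝ E]
    (L : E →L[ℝ] E) (μ : ℂ) : Prop :=
  Module.End.HasEigenvalue (LinearMap.baseChange ℂ (L : E →ₗ[ℝ] E)) μ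

/-- Neutral linear stability, up to a symmetry direction `v`, of the equilibrium `x` of
`dx/dt = F x`: all eigenvalues of the linearization `L` at `x` are purely imaginary, and the
solutions `η` of the linearized equation `dη/dt = L η` stay bounded for `t ≥ 0`, modulo
the line spanned by `v`, by a constant times their initial size. -/
def IsLinearlyStable {E : Type*} [NormedAddCommGroup E] [NormedSpace ℝ E]
    (F : E → E) (x v : E) : Prop :=
  ∃ L : E →L[ℝ] E, HasFDerivAt F L x ∧
    (∀ μ : ℂ, IsComplexEigenvalue L μ → μ.re = 0) ∧
    ∃ K : ℝ, ∀ η : ℝ → E, (∀ t : ℝ, HasDerivAt η (L (η t)) t) →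
      ∀ t : ℝ, 0 ≤ t → ∃ s : ℝ, ‖η t - s • v‖ ≤ K * ‖η 0‖

/-- Linear (exponential) instability of the equilibrium `x` of `dx/dt = F x`: the linearization
at `x` has an eigenvalue with positive real part. -/
def IsLinearlyUnstable {E : Type*} [NormedAddCommGroup E] [NormedSpace ℝ E]
    (F : E → E) (x : E) : Prop :=
  ∃ L : E →L[ℝ] E, HasFDerivAt F L x ∧ ∃ μ : ℂ, IsComplexEigenvalue L μ ∧ 0 < μ.re

/-- Linear stability of the ring as a relative equilibrium of the vortex system, i.e. modulo
the direction `i x` tangent to its orbit under rotations. -/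
def RingIsStable (N : ℕ) (f : ℝ → ℝ) (c R : ℝ) : Prop :=
  IsLinearlyStable (corotatingField (N := N) f c (ringFrequency N f c R))
    (ringPolygon N R) (Complex.I • ringPolygon N R)

/-- Linear instability of the ring as a relative equilibrium of the vortex system. -/
def RingIsUnstable (N : ℕ) (f : ℝ → ℝ) (c R : ℝ) : Prop :=
  IsLinearlyUnstable (corotatingField (N := N) f c (ringFrequency N f c R)) (ringPolygon N R)

end

open Complex Polynomial
open scoped ComplexConjugate

/-!
In the frame rotating with the polygon, a displacement `ζ ^ j * h j` turns the linearized
aggregation system into a combination of `Re h`, `h` and the conjugate of `rootInteraction ζ h`. The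
characters `j ↦ ζ ^ (j * m)`, and hence the real Hartley modes, are eigenfunctions of
`rootInteraction ζ` with real eigenvalues, so radial and tangential Hartley modes diagonalize the
aggregation system, with eigenvalues `λ₊(m)` and `λ₋(m)`.

The corotating vortex field is `i` times the aggregation field. Its linearization therefore
interchanges the radial and the tangential mode of each index `m`, which yields the planar systems
`u' = -λ₋(m) w`, `w' = λ₊(m) u`. Rotations account for `λ₋(0) = 0`. For `m ≥ 1` we have
`λ₋(m) < 0`, so the system is a centre, a drift or a saddle according to the sign of `λ₊(m)`, and
`λ₊` is largest at `m = ⌊N / 2⌋`.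
-/

section RootsOfUnity

variable {K : Type*} [Field K]

theorem sum_fin_pow_of_pow_eq_one [DecidableEq K] {N : ℕ} {r : K} (hr : r ^ N = 1) :
    ∑ k : Fin N, r ^ (k : ℕ) = if r = 1 then (N : K) else 0 := by
  split_ifs with h
  · simp [h]
  · have hgeom : (∑ k ∈ Finset.range N, r ^ k) * (r - 1) = 0 := by
      rw [geom_sum_mul, hr, sub_self]
    rw [Fin.sum_univ_eq_sum_range (r ^ ·)]
    exact (mul_eq_zero.mp hgeom).resolve_right (sub_ne_zero.mpr h)

section DistinctPoints

variable {ι : Type*} [Fintype ι] [DecidableEq ι] {y : ι → K}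

theorem sum_erase_pow_succ_div_sub (hy : Function.Injective y) (j : ι) (n : ℕ) :
    ∑ k ∈ Finset.univ.erase j, y k ^ (n + 1) / (y j - y k) =
      y j * ∑ k ∈ Finset.univ.erase j, y k ^ n / (y j - y k) -
        ∑ k ∈ Finset.univ.erase j, y k ^ n := by
  rw [Finset.mul_sum, ← Finset.sum_sub_distrib]
  refine Finset.sum_congr rfl fun k hk => ?_
  have hjk : y j - y k ≠ 0 := sub_ne_zero.mpr (hy.ne (Finset.ne_of_mem_erase hk).symm)
  field_simp
  ring

theorem sum_erase_pow_succ_sub_pow_succ_div_sq (hy : Function.Injective y) (j : ι) (n : ℕ) :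
    ∑ k ∈ Finset.univ.erase j, (y j ^ (n + 1) - y k ^ (n + 1)) / (y j - y k) ^ 2 =
      y j * ∑ k ∈ Finset.univ.erase j, (y j ^ n - y k ^ n) / (y j - y k) ^ 2 +
        ∑ k ∈ Finset.univ.erase j, y k ^ n / (y j - y k) := by
  rw [Finset.mul_sum, ← Finset.sum_add_distrib]
  refine Finset.sum_congr rfl fun k hk => ?_
  have hjk : y j - y k ≠ 0 := sub_ne_zero.mpr (hy.ne (Finset.ne_of_mem_erase hk).symm)
  field_simp
  ring

end DistinctPoints

variable {N : ℕ} {ζ : K}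

theorem pow_fin_injective_of_isPrimitiveRoot (hζ : IsPrimitiveRoot ζ N) :
    Function.Injective fun k : Fin N => ζ ^ (k : ℕ) :=
  fun j k h => Fin.ext (hζ.pow_inj j.2 k.2 h)

theorem pow_fin_add_of_pow_eq_one (hζ : ζ ^ N = 1) (j k : Fin N) :
    ζ ^ ((j + k : Fin N) : ℕ) = ζ ^ (j : ℕ) * ζ ^ (k : ℕ) := by
  rw [Fin.val_add, ← pow_eq_pow_mod _ hζ, pow_add]

theorem inv_sub_add_inv_sub_sq_div {x y : K} (hx : x ≠ 0) (hy : y ≠ 0) (hxy : x ≠ y) :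
    (x - y)⁻¹ + (x - x ^ 2 / y)⁻¹ = x⁻¹ := by
  have hxy' : x - y ≠ 0 := sub_ne_zero.mpr hxy
  have hrefl : x - x ^ 2 / y = -(x * (x - y)) / y := by
    field_simp
    ring
  rw [hrefl]
  field_simp
  ring

theorem sum_erase_inv_pow_sub_pow [NeZero (2 : K)] (hζ : IsPrimitiveRoot ζ N) (j : Fin N) :
    ∑ k ∈ Finset.univ.erase j, (ζ ^ (j : ℕ) - ζ ^ (k : ℕ))⁻¹ =
      ((N : K) - 1) / (2 * ζ ^ (j : ℕ)) := by
  have : NeZero N := ⟨(Fin.pos j).ne'⟩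
  have hpow (k : Fin N) : ζ ^ (k : ℕ) ≠ 0 := pow_ne_zero _ (hζ.ne_zero (NeZero.ne N))
  have hj := hpow j
  have h2 : (2 : K) ≠ 0 := two_ne_zero
  -- The reflection `y ↦ x² / y` about `x = ζ ^ j` permutes the roots of unity.
  have hpair (k : Fin N) : (ζ ^ (j : ℕ) - ζ ^ (k : ℕ))⁻¹ +
      (ζ ^ (j : ℕ) - ζ ^ ((j + j - k : Fin N) : ℕ))⁻¹ = if k = j then 0 else (ζ ^ (j : ℕ))⁻¹ := by
    split_ifs with hkj
    · simp [hkj]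
    · have hrefl : ζ ^ ((j + j - k : Fin N) : ℕ) = (ζ ^ (j : ℕ)) ^ 2 / ζ ^ (k : ℕ) := by
        rw [eq_div_iff (hpow k), ← pow_fin_add_of_pow_eq_one hζ.pow_eq_one, sub_add_cancel,
          pow_fin_add_of_pow_eq_one hζ.pow_eq_one, sq]
      rw [hrefl]
      exact inv_sub_add_inv_sub_sq_div hj (hpow k)
        ((pow_fin_injective_of_isPrimitiveRoot hζ).ne (Ne.symm hkj))
  have hreindex : ∑ k : Fin N, (ζ ^ (j : ℕ) - ζ ^ ((j + j - k : Fin N) : ℕ))⁻¹ =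
      ∑ k : Fin N, (ζ ^ (j : ℕ) - ζ ^ (k : ℕ))⁻¹ :=
    (Equiv.subLeft (j + j)).sum_comp fun k : Fin N => (ζ ^ (j : ℕ) - ζ ^ (k : ℕ))⁻¹
  have hcount : ∑ k : Fin N, (if k = j then 0 else (ζ ^ (j : ℕ))⁻¹) =
      ((N : K) - 1) * (ζ ^ (j : ℕ))⁻¹ := by
    simp [Finset.sum_ite, Finset.filter_ne', Nat.cast_pred (Fin.pos j)]
  -- The term `k = j` may be included, since `0⁻¹ = 0`.
  rw [Finset.sum_erase _ (by rw [sub_self, inv_zero])]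
  have hdouble := Finset.sum_congr rfl fun k (_ : k ∈ Finset.univ) => hpair k
  rw [Finset.sum_add_distrib, hreindex, ← two_mul, hcount] at hdouble
  field_simp at hdouble ⊢
  exact hdouble

theorem sum_erase_pow_div_pow_sub_pow [NeZero (2 : K)] (hζ : IsPrimitiveRoot ζ N) (j : Fin N)
    {n : ℕ} (hn : n < N) :
    ∑ k ∈ Finset.univ.erase j, (ζ ^ (k : ℕ)) ^ (n + 1) / (ζ ^ (j : ℕ) - ζ ^ (k : ℕ)) =
      (ζ ^ (j : ℕ)) ^ n * (n - ((N : K) - 1) / 2) := by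
  classical
  have hsucc := sum_erase_pow_succ_div_sub (pow_fin_injective_of_isPrimitiveRoot hζ) j
  have hj : ζ ^ (j : ℕ) ≠ 0 := pow_ne_zero _ (hζ.ne_zero (Fin.pos j).ne')
  have h2 : (2 : K) ≠ 0 := two_ne_zero
  induction n with
  | zero =>
    simp only [hsucc, pow_zero, one_div, sum_erase_inv_pow_sub_pow hζ, Finset.sum_const,
      Finset.card_erase_of_mem (Finset.mem_univ j), Finset.card_fin, nsmul_eq_mul, mul_one,
      Nat.cast_pred (Fin.pos j), Nat.cast_zero]
    field_simp
    ring
  | succ n ih =>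
    have hpowers : ∑ k ∈ Finset.univ.erase j, (ζ ^ (k : ℕ)) ^ (n + 1) =
        -(ζ ^ (j : ℕ)) ^ (n + 1) := by
      rw [Finset.sum_erase_eq_sub (Finset.mem_univ j)]
      simp only [pow_right_comm ζ _ (n + 1)]
      rw [sum_fin_pow_of_pow_eq_one (by rw [pow_right_comm, hζ.pow_eq_one, one_pow]),
        if_neg (hζ.pow_ne_one_of_pos_of_lt n.succ_ne_zero hn), zero_sub]
    rw [hsucc, ih (by lia), hpowers]
    push_cast
    ring

/-- The linearized pairwise interaction of the vertices `ζ ^ j` of a regular polygon, acting on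
displacements of the form `ζ ^ j * h j`, that is, written in the frame rotating with the polygon. -/
def rootInteraction (ζ : K) : (Fin N → K) →ₗ[K] (Fin N → K) where
  toFun h j := ζ ^ (j : ℕ) * ∑ k ∈ Finset.univ.erase j,
    (ζ ^ (j : ℕ) * h j - ζ ^ (k : ℕ) * h k) / (ζ ^ (j : ℕ) - ζ ^ (k : ℕ)) ^ 2
  map_add' g h := by
    funext j
    simp only [Pi.add_apply, Finset.mul_sum, ← Finset.sum_add_distrib]
    exact Finset.sum_congr rfl fun k _ => by ring
  map_smul' a h := by
    funext j
    simp only [Pi.smul_apply, smul_eq_mul, Finset.mul_sum, RingHom.id_apply]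
    exact Finset.sum_congr rfl fun k _ => by ring

theorem rootInteraction_apply (ζ : K) (h : Fin N → K) (j : Fin N) :
    rootInteraction ζ h j = ζ ^ (j : ℕ) * ∑ k ∈ Finset.univ.erase j,
      (ζ ^ (j : ℕ) * h j - ζ ^ (k : ℕ) * h k) / (ζ ^ (j : ℕ) - ζ ^ (k : ℕ)) ^ 2 :=
  rfl

theorem rootInteraction_pow [NeZero (2 : K)] (hζ : IsPrimitiveRoot ζ N) {m : ℕ} (hm : m < N) :
    rootInteraction ζ (fun j : Fin N => (ζ ^ (j : ℕ)) ^ m) =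
      (-((m - 1) * ((N : K) - m - 1)) / 2) • fun j : Fin N => (ζ ^ (j : ℕ)) ^ m := by
  funext j
  have hj : ζ ^ (j : ℕ) ≠ 0 := pow_ne_zero _ (hζ.ne_zero (Fin.pos j).ne')
  have h2 : (2 : K) ≠ 0 := two_ne_zero
  have hsucc :=
    sum_erase_pow_succ_sub_pow_succ_div_sq (pow_fin_injective_of_isPrimitiveRoot hζ) j
  simp only [rootInteraction_apply, Pi.smul_apply, smul_eq_mul, ← pow_succ']
  induction m with
  | zero =>
    simp only [hsucc, pow_zero, sub_self, zero_div, Finset.sum_const_zero, mul_zero, zero_add,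
      one_div, sum_erase_inv_pow_sub_pow hζ, Nat.cast_zero]
    field_simp
    ring
  | succ m ih =>
    rw [hsucc, mul_add, mul_left_comm, ih (by lia), sum_erase_pow_div_pow_sub_pow hζ j (by lia)]
    push_cast
    field_simp
    ring

end RootsOfUnity

section HartleyModes

variable {N : ℕ} {ζ : ℂ}

theorem conj_pow_fin (hζ : IsPrimitiveRoot ζ N) (j : Fin N) :
    conj (ζ ^ (j : ℕ)) = (ζ ^ (j : ℕ))⁻¹ := by
  rw [inv_eq_conj]
  rw [norm_pow, norm_eq_one_of_pow_eq_one hζ.pow_eq_one (Fin.pos j).ne', one_pow]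

theorem rootInteraction_inv_pow (hζ : IsPrimitiveRoot ζ N) (m : Fin N) :
    rootInteraction ζ (fun j : Fin N => ((ζ ^ (j : ℕ)) ^ (m : ℕ))⁻¹) =
      (-((m - 1) * ((N : ℂ) - m - 1)) / 2) • fun j : Fin N => ((ζ ^ (j : ℕ)) ^ (m : ℕ))⁻¹ := by
  rcases Nat.eq_zero_or_pos m with hm | hm
  · simpa [hm] using rootInteraction_pow hζ m.pos
  · have hinv : (fun j : Fin N => ((ζ ^ (j : ℕ)) ^ (m : ℕ))⁻¹) =
        fun j : Fin N => (ζ ^ (j : ℕ)) ^ (N - m : ℕ) := by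
      funext j
      refine inv_eq_of_mul_eq_one_left ?_
      rw [← pow_add, Nat.sub_add_cancel m.2.le, pow_right_comm, hζ.pow_eq_one, one_pow]
    rw [hinv, rootInteraction_pow hζ (Nat.sub_lt m.pos hm), Nat.cast_sub m.2.le]
    congr 1
    ring

/-- The Hartley mode of index `m`: real part plus imaginary part of the character
`j ↦ (ζ ^ j) ^ m`. Unlike the characters themselves, these `N` functions are real, and they still
diagonalize `rootInteraction ζ`. -/
def hartleyMode (ζ : ℂ) (m j : Fin N) : ℝ :=
  ((ζ ^ (j : ℕ)) ^ (m : ℕ)).re + ((ζ ^ (j : ℕ)) ^ (m : ℕ)).im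

theorem hartleyMode_zero [NeZero N] (ζ : ℂ) (j : Fin N) : hartleyMode ζ 0 j = 1 := by
  simp [hartleyMode]

theorem hartleyMode_eq (hζ : IsPrimitiveRoot ζ N) (m j : Fin N) :
    (hartleyMode ζ m j : ℂ) = (1 - I) / 2 * (ζ ^ (j : ℕ)) ^ (m : ℕ) +
      (1 + I) / 2 * ((ζ ^ (j : ℕ)) ^ (m : ℕ))⁻¹ := by
  rw [← inv_pow, ← conj_pow_fin hζ, ← map_pow, hartleyMode]
  generalize (ζ ^ (j : ℕ)) ^ (m : ℕ) = w
  apply Complex.ext <;> simp <;> ring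

theorem rootInteraction_hartleyMode (hζ : IsPrimitiveRoot ζ N) (m : Fin N) :
    rootInteraction ζ (fun j => (hartleyMode ζ m j : ℂ)) =
      (-((m - 1) * ((N : ℂ) - m - 1)) / 2) • fun j => (hartleyMode ζ m j : ℂ) := by
  have hmode : (fun j => (hartleyMode ζ m j : ℂ)) =
      ((1 - I) / 2) • (fun j : Fin N => (ζ ^ (j : ℕ)) ^ (m : ℕ)) +
        ((1 + I) / 2) • fun j : Fin N => ((ζ ^ (j : ℕ)) ^ (m : ℕ))⁻¹ :=
    funext fun j => hartleyMode_eq hζ m j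
  rw [hmode, map_add, map_smul, map_smul, rootInteraction_pow hζ m.2, rootInteraction_inv_pow hζ,
    smul_comm, smul_comm ((1 + I) / 2), ← smul_add]

theorem hartleyMode_mul_hartleyMode (hζ : IsPrimitiveRoot ζ N) (l m j : Fin N) :
    hartleyMode ζ l j * hartleyMode ζ m j =
      ((ζ ^ (l : ℕ) * (ζ ^ (m : ℕ))⁻¹) ^ (j : ℕ)).re +
        ((ζ ^ (l : ℕ) * ζ ^ (m : ℕ)) ^ (j : ℕ)).im := by
  have hconj : ((ζ ^ (j : ℕ)) ^ (m : ℕ))⁻¹ = conj ((ζ ^ (j : ℕ)) ^ (m : ℕ)) := by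
    rw [map_pow, conj_pow_fin hζ, inv_pow]
  simp only [mul_pow, inv_pow, pow_right_comm ζ _ (j : ℕ), hconj, hartleyMode, mul_re, mul_im,
    conj_re, conj_im]
  ring

theorem sum_hartleyMode_mul_hartleyMode (hζ : IsPrimitiveRoot ζ N) (l m : Fin N) :
    ∑ j, hartleyMode ζ l j * hartleyMode ζ m j = if l = m then (N : ℝ) else 0 := by
  have hN (n : ℕ) : (ζ ^ n) ^ N = 1 := by rw [pow_right_comm, hζ.pow_eq_one, one_pow]
  have hone : ζ ^ (l : ℕ) * (ζ ^ (m : ℕ))⁻¹ = 1 ↔ l = m := by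
    rw [mul_inv_eq_one₀ (pow_ne_zero _ (hζ.ne_zero l.pos.ne'))]
    exact (pow_fin_injective_of_isPrimitiveRoot hζ).eq_iff
  simp only [hartleyMode_mul_hartleyMode hζ]
  rw [Finset.sum_add_distrib, ← re_sum, ← im_sum,
    sum_fin_pow_of_pow_eq_one (by rw [mul_pow, inv_pow, hN, hN, inv_one, one_mul]),
    sum_fin_pow_of_pow_eq_one (by rw [mul_pow, hN, hN, one_mul])]
  simp only [hone]
  split_ifs <;> simp

theorem linearIndependent_hartleyMode (hζ : IsPrimitiveRoot ζ N) :
    LinearIndependent ℝ (hartleyMode (N := N) ζ) := by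
  rw [Fintype.linearIndependent_iff]
  intro g hg m
  have hN : (N : ℝ) ≠ 0 := Nat.cast_ne_zero.mpr m.pos.ne'
  have hm : ∑ j, (∑ l, g l • hartleyMode ζ l) j * hartleyMode ζ m j = g m * N := by
    simp only [Finset.sum_apply, Pi.smul_apply, smul_eq_mul, Finset.sum_mul, mul_assoc]
    rw [Finset.sum_comm]
    simp [← Finset.mul_sum, sum_hartleyMode_mul_hartleyMode hζ]
  rw [hg] at hm
  simpa [hN] using hm.symm

/-- The displacement of the polygon with vertices `ζ ^ j` that is `hartleyMode ζ m j` in the frame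
rotating with the polygon. It is radial, and its multiple by `i` is tangential. -/
def radialMode (ζ : ℂ) (m j : Fin N) : ℂ :=
  ζ ^ (j : ℕ) * hartleyMode ζ m j

theorem linearIndependent_radialMode (hζ : IsPrimitiveRoot ζ N) :
    LinearIndependent ℂ (radialMode (N := N) ζ) := by
  have hunit : IsUnit fun j : Fin N => ζ ^ (j : ℕ) :=
    Pi.isUnit_iff.mpr fun j => (pow_ne_zero _ (hζ.ne_zero j.pos.ne')).isUnit
  have hmodes : LinearIndependent ℂ fun m : Fin N => algebraMap ℝ ℂ ∘ hartleyMode ζ m :=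
    linearIndependent_algebraMap_comp_iff.mpr (linearIndependent_hartleyMode hζ)
  exact hmodes.map' (LinearMap.mulLeft ℂ _) (LinearMap.ker_eq_bot.mpr hunit.mul_right_injective)

/-- The real basis of `ℂ ^ N` formed by the radial modes (index `0`) and the corresponding
tangential modes (index `1`). -/
noncomputable def polygonBasis [NeZero N] (hζ : IsPrimitiveRoot ζ N) :
    Module.Basis (Fin 2 × Fin N) ℝ (Fin N → ℂ) :=
  basisOneI.smulTower
    (basisOfLinearIndependentOfCardEqFinrank (linearIndependent_radialMode hζ) (by simp))

theorem polygonBasis_zero [NeZero N] (hζ : IsPrimitiveRoot ζ N) (m : Fin N) :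
    polygonBasis hζ (0, m) = radialMode ζ m := by
  simp [polygonBasis, Module.Basis.smulTower_apply]

theorem polygonBasis_one [NeZero N] (hζ : IsPrimitiveRoot ζ N) (m : Fin N) :
    polygonBasis hζ (1, m) = I • radialMode ζ m := by
  simp [polygonBasis, Module.Basis.smulTower_apply]

end HartleyModes

section AggregationField

theorem hasFDerivAt_apply_norm_smul {E : Type*} [NormedAddCommGroup E] [InnerProductSpace ℝ E]
    {g : ℝ → ℝ} {g' : ℝ} {z : E} (hg : HasDerivAt g g' ‖z‖) (hz : z ≠ 0) :
    HasFDerivAt (fun x => g ‖x‖ • x)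
      (g ‖z‖ • ContinuousLinearMap.id ℝ E + ((g' / ‖z‖) • innerSL ℝ z).smulRight z) z := by
  have hnorm : HasFDerivAt (‖·‖) (‖z‖⁻¹ • innerSL ℝ z) z := by
    have h := (hasStrictFDerivAt_norm_sq z).hasFDerivAt.sqrt (by simpa using hz)
    simp only [Real.sqrt_sq (norm_nonneg _)] at h
    refine h.congr_fderiv ?_
    rw [← Nat.cast_smul_eq_nsmul ℝ, smul_smul]
    congr 1
    field_simp
    simp
  refine ((hg.comp_hasFDerivAt z hnorm).smul (hasFDerivAt_id z)).congr_fderiv ?_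
  simp [smul_smul, div_eq_mul_inv]

theorem div_norm_sq_eq_conj_inv (z : ℂ) : z / ((‖z‖ ^ 2 : ℝ) : ℂ) = conj z⁻¹ := by
  rw [map_inv₀, inv_def, conj_conj, normSq_conj, normSq_eq_norm_sq, div_eq_mul_inv, ofReal_inv]

theorem hasFDerivAt_div_norm_sq {z : ℂ} (hz : z ≠ 0) :
    HasFDerivAt (fun w : ℂ => w / ((‖w‖ ^ 2 : ℝ) : ℂ))
      (-(conjCLE : ℂ →L[ℝ] ℂ) ∘L ContinuousLinearMap.mul ℝ ℂ (z ^ 2)⁻¹) z := by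
  simp only [div_norm_sq_eq_conj_inv]
  refine (conjCLE.hasFDerivAt.comp z
    ((hasDerivAt_inv hz).hasFDerivAt.restrictScalars ℝ)).congr_fderiv ?_
  ext v
  simp [mul_comm]

theorem exists_hasFDerivAt_aggregationField {N : ℕ} {f : ℝ → ℝ} (c ω : ℝ) {z : Fin N → ℂ}
    (hz : ∀ j, z j ≠ 0) (hinj : Function.Injective z) (hf : ∀ j, DifferentiableAt ℝ f ‖z j‖) :
    ∃ A : (Fin N → ℂ) →L[ℝ] (Fin N → ℂ), HasFDerivAt (aggregationField f c ω) A z ∧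
      ∀ v j, A v j = (f ‖z j‖ - ω) • v j + (deriv f ‖z j‖ / ‖z j‖ * inner ℝ (z j) (v j)) • z j -
        c • conj (∑ k ∈ Finset.univ.erase j, (v j - v k) / (z j - z k) ^ 2) := by
  have hself (j : Fin N) := HasFDerivAt.comp z (f := fun x : Fin N → ℂ => x j)
    (hasFDerivAt_apply_norm_smul ((hf j).hasDerivAt.sub_const ω) (hz j)) (hasFDerivAt_apply j z)
  have hpair (j : Fin N) (k) (hk : k ∈ Finset.univ.erase j) :=
    HasFDerivAt.comp z (f := fun x : Fin N → ℂ => x j - x k)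
      (hasFDerivAt_div_norm_sq (sub_ne_zero.mpr (hinj.ne (Finset.ne_of_mem_erase hk).symm)))
      ((hasFDerivAt_apply j z).fun_sub (hasFDerivAt_apply k z))
  have hcomp (j : Fin N) := (hself j).fun_add ((HasFDerivAt.fun_sum (hpair j)).const_smul c)
  refine ⟨_, hasFDerivAt_pi.mpr hcomp, fun v j => ?_⟩
  simp [div_eq_inv_mul, mul_sub, neg_add_eq_sub, Finset.sum_sub_distrib, add_sub_assoc',
    sub_sub_eq_add_sub]

end AggregationField

section Ring

/-- The primitive `N`-th root of unity whose powers are the directions of the vertices of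
`ringPolygon N R`. -/
noncomputable def ringRoot (N : ℕ) : ℂ :=
  exp (2 * Real.pi * I / N)

variable {N : ℕ} {R : ℝ}

theorem isPrimitiveRoot_ringRoot (hN : N ≠ 0) : IsPrimitiveRoot (ringRoot N) N :=
  isPrimitiveRoot_exp N hN

theorem ringPolygon_apply (R : ℝ) (j : Fin N) :
    ringPolygon N R j = R * ringRoot N ^ (j : ℕ) := by
  rw [ringPolygon, ringRoot, ← exp_nat_mul, mul_comm ((j : ℕ) : ℂ)]

theorem norm_ringRoot_pow (j : Fin N) : ‖ringRoot N ^ (j : ℕ)‖ = 1 := by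
  rw [norm_pow, norm_eq_one_of_pow_eq_one (isPrimitiveRoot_ringRoot j.pos.ne').pow_eq_one
    j.pos.ne', one_pow]

theorem norm_ringPolygon_apply (hR : 0 ≤ R) (j : Fin N) : ‖ringPolygon N R j‖ = R := by
  rw [ringPolygon_apply, norm_mul, norm_ringRoot_pow, mul_one, norm_real, Real.norm_of_nonneg hR]

theorem ringPolygon_injective (hR : R ≠ 0) : Function.Injective (ringPolygon N R) := by
  intro j k h
  rw [ringPolygon_apply, ringPolygon_apply] at h
  exact pow_fin_injective_of_isPrimitiveRoot (isPrimitiveRoot_ringRoot j.pos.ne')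
    (mul_left_cancel₀ (ofReal_ne_zero.mpr hR) h)

theorem aggregationField_ringPolygon (f : ℝ → ℝ) (c : ℝ) (hR : 0 < R) :
    aggregationField f c (ringFrequency N f c R) (ringPolygon N R) = 0 := by
  funext j
  have hζ := isPrimitiveRoot_ringRoot j.pos.ne'
  have hj : ringRoot N ^ (j : ℕ) ≠ 0 := pow_ne_zero _ (hζ.ne_zero j.pos.ne')
  have hR' : (R : ℂ) ≠ 0 := ofReal_ne_zero.mpr hR.ne'
  have hsum : ∑ k ∈ Finset.univ.erase j, conj (ringPolygon N R j - ringPolygon N R k)⁻¹ =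
      (N - 1) / (2 * R) * ringRoot N ^ (j : ℕ) := by
    simp only [ringPolygon_apply, ← mul_sub, mul_inv]
    rw [← map_sum, ← Finset.mul_sum, sum_erase_inv_pow_sub_pow hζ]
    simp only [map_mul, map_div₀, map_inv₀, map_sub, map_natCast, map_one, map_ofNat,
      conj_pow_fin hζ, conj_ofReal]
    field_simp
  rw [aggregationField]
  simp only [div_norm_sq_eq_conj_inv]
  rw [hsum, norm_ringPolygon_apply hR.le, ringFrequency, ringPolygon_apply, Pi.zero_apply]
  push_cast
  field_simp
  ring

theorem exists_hasFDerivAt_aggregationField_ringPolygon {f : ℝ → ℝ} (c : ℝ) (hR : 0 < R)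
    (hf : DifferentiableAt ℝ f R) :
    ∃ A : (Fin N → ℂ) →L[ℝ] (Fin N → ℂ),
      HasFDerivAt (aggregationField f c (ringFrequency N f c R)) A (ringPolygon N R) ∧
      ∀ (h : Fin N → ℂ) (j : Fin N), A (fun j => ringRoot N ^ (j : ℕ) * h j) j =
        ringRoot N ^ (j : ℕ) * (deriv f R * R * (h j).re - c * (N - 1) / (2 * R ^ 2) * h j -
          c / R ^ 2 * conj (rootInteraction (ringRoot N) h j)) := by
  have hnorm := norm_ringPolygon_apply (N := N) hR.le
  obtain ⟨A, hA, hAv⟩ := exists_hasFDerivAt_aggregationField c (ringFrequency N f c R)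
    (fun j => norm_ne_zero_iff.mp ((hnorm j).trans_ne hR.ne')) (ringPolygon_injective hR.ne')
    (fun j => (hnorm j).symm ▸ hf)
  refine ⟨A, hA, fun h j => ?_⟩
  have hζ := isPrimitiveRoot_ringRoot j.pos.ne'
  have hj : ringRoot N ^ (j : ℕ) ≠ 0 := pow_ne_zero _ (hζ.ne_zero j.pos.ne')
  have hR' : (R : ℂ) ≠ 0 := ofReal_ne_zero.mpr hR.ne'
  have hinner : inner ℝ (ringPolygon N R j) (ringRoot N ^ (j : ℕ) * h j) = R * (h j).re := by
    have hcancel : ringRoot N ^ (j : ℕ) * h j * (R * (ringRoot N ^ (j : ℕ))⁻¹) = R * h j := by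
      field_simp
    rw [Complex.inner, ringPolygon_apply, map_mul, conj_ofReal, conj_pow_fin hζ, hcancel,
      re_ofReal_mul]
  have hsum : ∑ k ∈ Finset.univ.erase j,
      (ringRoot N ^ (j : ℕ) * h j - ringRoot N ^ (k : ℕ) * h k) /
        (ringPolygon N R j - ringPolygon N R k) ^ 2 =
      ((R : ℂ) ^ 2 * ringRoot N ^ (j : ℕ))⁻¹ * rootInteraction (ringRoot N) h j := by
    rw [rootInteraction_apply, mul_inv, mul_assoc, inv_mul_cancel_left₀ hj, Finset.mul_sum]
    refine Finset.sum_congr rfl fun k _ => ?_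
    rw [ringPolygon_apply, ringPolygon_apply, ← mul_sub, mul_pow, div_mul_eq_div_div_swap,
      div_eq_inv_mul _ ((R : ℂ) ^ 2)]
  rw [hAv, hinner, hsum, hnorm, map_mul, map_inv₀, map_mul, map_pow, conj_ofReal, conj_pow_fin hζ,
    ringPolygon_apply, ringFrequency]
  simp only [real_smul]
  push_cast
  field_simp
  ring

theorem exists_hasFDerivAt_aggregationField_radialMode {f : ℝ → ℝ} (c : ℝ) (hR : 0 < R)
    (hf : DifferentiableAt ℝ f R) :
    ∃ A : (Fin N → ℂ) →L[ℝ] (Fin N → ℂ),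
      HasFDerivAt (aggregationField f c (ringFrequency N f c R)) A (ringPolygon N R) ∧
      (∀ m : Fin N, A (radialMode (ringRoot N) m) =
        lambdaPlus N f c R m • radialMode (ringRoot N) m) ∧
      ∀ m : Fin N, A (I • radialMode (ringRoot N) m) =
        lambdaMinus N c R m • I • radialMode (ringRoot N) m := by
  obtain ⟨A, hA, hAh⟩ := exists_hasFDerivAt_aggregationField_ringPolygon c hR hf
  have hR' : (R : ℂ) ≠ 0 := ofReal_ne_zero.mpr hR.ne'
  have hmode (m j : Fin N) : rootInteraction (ringRoot N)
      (fun j => (hartleyMode (ringRoot N) m j : ℂ)) j =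
      ((-((m - 1) * (N - m - 1)) / 2 : ℝ) : ℂ) * hartleyMode (ringRoot N) m j := by
    rw [rootInteraction_hartleyMode (isPrimitiveRoot_ringRoot m.pos.ne'), Pi.smul_apply,
      smul_eq_mul]
    push_cast
    rfl
  refine ⟨A, hA, fun m => funext fun j => ?_, fun m => funext fun j => ?_⟩
  · refine (hAh _ j).trans ?_
    rw [hmode, map_mul, conj_ofReal, conj_ofReal, ofReal_re, Pi.smul_apply, radialMode, real_smul,
      lambdaPlus]
    push_cast
    field_simp
    ring
  · have hI : I • radialMode (ringRoot N) m = fun j : Fin N =>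
        ringRoot N ^ (j : ℕ) * (I • fun j => (hartleyMode (ringRoot N) m j : ℂ)) j :=
      funext fun j => mul_left_comm _ _ _
    rw [hI, hAh, map_smul]
    simp only [Pi.smul_apply, hmode, smul_eq_mul, map_mul, conj_ofReal, conj_I, I_mul_re, ofReal_im,
      real_smul, lambdaMinus]
    push_cast
    field_simp
    ring

end Ring

section LinearFlows

/-- Boundedness, modulo the line spanned by `v`, of the forward solutions of `dη/dt = L η`, by a
constant times their initial size: the boundedness clause of `IsLinearlyStable`. -/
def IsFlowBoundedModulo {E : Type*} [NormedAddCommGroup E] [NormedSpace ℝ E]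
    (L : E →L[ℝ] E) (v : E) : Prop :=
  ∃ K : ℝ, ∀ η : ℝ → E, (∀ t : ℝ, HasDerivAt η (L (η t)) t) →
    ∀ t : ℝ, 0 ≤ t → ∃ s : ℝ, ‖η t - s • v‖ ≤ K * ‖η 0‖

theorem abs_le_of_hasDerivAt_of_mul_neg {p q : ℝ} (hpq : p * q < 0) {u w : ℝ → ℝ}
    (hu : ∀ t, HasDerivAt u (q * w t) t) (hw : ∀ t, HasDerivAt w (p * u t) t) (t : ℝ) :
    |u t| ≤ |u 0| + √(-(q / p)) * |w 0| := by
  have hp : p ≠ 0 := left_ne_zero_of_mul hpq.ne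
  have ha : 0 ≤ -(q / p) := by
    rw [← mul_div_mul_left q p hp, ← neg_div]
    exact div_nonneg (neg_nonneg.mpr hpq.le) (mul_self_nonneg p)
  have hderiv (s : ℝ) : HasDerivAt (fun s => u s ^ 2 + -(q / p) * w s ^ 2) 0 s := by
    refine (((hu s).fun_pow 2).fun_add (((hw s).fun_pow 2).const_mul _)).congr_deriv ?_
    field_simp
    ring
  have henergy : u t ^ 2 + -(q / p) * w t ^ 2 = u 0 ^ 2 + -(q / p) * w 0 ^ 2 :=
    is_const_of_deriv_eq_zero (fun s => (hderiv s).differentiableAt) (fun s => (hderiv s).deriv) t 0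
  refine abs_le_of_sq_le_sq ?_ (by positivity)
  calc u t ^ 2 ≤ u 0 ^ 2 + -(q / p) * w 0 ^ 2 := by linarith [mul_nonneg ha (sq_nonneg (w t))]
    _ = |u 0| ^ 2 + (√(-(q / p)) * |w 0|) ^ 2 := by
      rw [mul_pow, Real.sq_sqrt ha, sq_abs, sq_abs]
    _ ≤ (|u 0| + √(-(q / p)) * |w 0|) ^ 2 :=
      pow_add_pow_le (by positivity) (by positivity) two_ne_zero

variable {ι E : Type*} [Finite ι] [NormedAddCommGroup E] [NormedSpace ℝ E]

theorem hasDerivAt_basis_repr (b : Module.Basis ι ℝ E) {η : ℝ → E} {η' : E} {t : ℝ}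
    (hη : HasDerivAt η η' t) (i : ι) : HasDerivAt (fun t => b.repr (η t) i) (b.repr η' i) t :=
  have := b.finiteDimensional_of_finite
  (b.coord i).toContinuousLinearMap.hasFDerivAt.comp_hasDerivAt t hη

theorem exists_abs_basis_repr_le (b : Module.Basis ι ℝ E) (i : ι) :
    ∃ K, 0 ≤ K ∧ ∀ x, |b.repr x i| ≤ K * ‖x‖ :=
  have := b.finiteDimensional_of_finite
  ⟨_, norm_nonneg _, (b.coord i).toContinuousLinearMap.le_opNorm⟩

theorem isFlowBoundedModulo_of_repr_le (b : Module.Basis ι ℝ E) {L : E →L[ℝ] E} {i : ι}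
    {r : ℝ} (hr : r ≠ 0)
    (hb : ∀ k ≠ i, ∃ K, ∀ η : ℝ → E, (∀ t, HasDerivAt η (L (η t)) t) →
      ∀ t, |b.repr (η t) k| ≤ K * ‖η 0‖) : IsFlowBoundedModulo L (r • b i) := by
  classical
  have := Fintype.ofFinite ι
  choose! K hK using hb
  refine ⟨∑ k ∈ Finset.univ.erase i, K k * ‖b k‖, fun η hη t _ => ⟨b.repr (η t) i / r, ?_⟩⟩
  have hsum : η t - (b.repr (η t) i / r) • r • b i =
      ∑ k ∈ Finset.univ.erase i, b.repr (η t) k • b k := by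
    rw [smul_smul, div_mul_cancel₀ _ hr, Finset.sum_erase_eq_sub (Finset.mem_univ i), b.sum_repr]
  rw [hsum, Finset.sum_mul]
  refine norm_sum_le_of_le _ fun k hk => ?_
  rw [norm_smul, Real.norm_eq_abs, mul_right_comm]
  gcongr
  exact hK k (Finset.ne_of_mem_erase hk) η hη t

end LinearFlows

section PairedOperators

variable {ι 𝕜 E : Type*}

/-- `T` interchanges the two vectors `b (0, m)` and `b (1, m)` of each pair of the basis `b`, up to
the factors `p m` and `q m`. In the coordinates of `b`, the equation `x' = T x` thus splits into
the planar systems `u' = q m * w`, `w' = p m * u`. -/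
structure IsPaired [CommRing 𝕜] [AddCommGroup E] [Module 𝕜 E]
    (b : Module.Basis (Fin 2 × ι) 𝕜 E) (T : E →ₗ[𝕜] E) (p q : ι → 𝕜) : Prop where
  apply_zero (m : ι) : T (b (0, m)) = p m • b (1, m)
  apply_one (m : ι) : T (b (1, m)) = q m • b (0, m)

namespace IsPaired

section Algebraic

variable [CommRing 𝕜] [AddCommGroup E] [Module 𝕜 E] {b : Module.Basis (Fin 2 × ι) 𝕜 E}
  {T : E →ₗ[𝕜] E} {p q : ι → 𝕜}

theorem repr_apply_zero (h : IsPaired b T p q) (x : E) (m : ι) :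
    b.repr (T x) (0, m) = q m * b.repr x (1, m) := by
  have hcoord : b.coord (0, m) ∘ₗ T = q m • b.coord (1, m) := by
    refine b.ext fun ⟨i, k⟩ => ?_
    fin_cases i
    · simp [h.apply_zero]
    · by_cases hk : k = m <;> simp [h.apply_one, hk]
  exact LinearMap.congr_fun hcoord x

theorem repr_apply_one (h : IsPaired b T p q) (x : E) (m : ι) :
    b.repr (T x) (1, m) = p m * b.repr x (0, m) := by
  have hcoord : b.coord (1, m) ∘ₗ T = p m • b.coord (0, m) := by
    refine b.ext fun ⟨i, k⟩ => ?_
    fin_cases i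
    · by_cases hk : k = m <;> simp [h.apply_zero, hk]
    · simp [h.apply_one]
  exact LinearMap.congr_fun hcoord x

theorem baseChange (h : IsPaired b T p q) (A : Type*) [CommRing A] [Algebra 𝕜 A] :
    IsPaired (b.baseChange A) (T.baseChange A) (algebraMap 𝕜 A ∘ p) (algebraMap 𝕜 A ∘ q) where
  apply_zero m := by simp [h.apply_zero]
  apply_one m := by simp [h.apply_one]

theorem exists_sq_eq_of_hasEigenvalue [NoZeroDivisors 𝕜] (h : IsPaired b T p q) {μ : 𝕜}
    (hμ : Module.End.HasEigenvalue T μ) : ∃ m, μ ^ 2 = p m * q m := by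
  obtain ⟨x, hx⟩ := hμ.exists_hasEigenvector
  obtain ⟨⟨i, m⟩, him⟩ := Finsupp.ne_iff.mp (b.repr.map_ne_zero_iff.mpr hx.2)
  have hsq : T (T x) = μ ^ 2 • x := by
    rw [hx.apply_eq_smul, map_smul, hx.apply_eq_smul, smul_smul, sq]
  have hcoord : b.repr (T (T x)) (i, m) = p m * q m * b.repr x (i, m) := by
    fin_cases i
    · simp only [Fin.zero_eta, h.repr_apply_zero, h.repr_apply_one]
      ring
    · simp only [Fin.mk_one, h.repr_apply_zero, h.repr_apply_one]
      ring
  rw [hsq, map_smul, Finsupp.smul_apply, smul_eq_mul] at hcoord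
  exact ⟨m, mul_right_cancel₀ him hcoord⟩

theorem hasEigenvalue_of_sq_eq (h : IsPaired b T p q) {m : ι} (hq : q m ≠ 0) {μ : 𝕜}
    (hμ : μ ^ 2 = p m * q m) : Module.End.HasEigenvalue T μ := by
  refine Module.End.hasEigenvalue_of_hasEigenvector (x := q m • b (0, m) + μ • b (1, m))
    ⟨Module.End.mem_eigenspace_iff.mpr ?_, fun hzero => hq ?_⟩
  · rw [map_add, map_smul, map_smul, h.apply_zero, h.apply_one, smul_add]
    simp only [smul_smul, ← sq, hμ, mul_comm (q m)]
    rw [add_comm]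
  · simpa using congrArg (b.coord (0, m)) hzero

end Algebraic

section Flow

variable [NormedAddCommGroup E] [NormedSpace ℝ E] {b : Module.Basis (Fin 2 × ι) ℝ E}
  {L : E →L[ℝ] E} {p q : ι → ℝ}

theorem isComplexEigenvalue_sqrt (h : IsPaired b (L : E →ₗ[ℝ] E) p q) {m : ι}
    (hpq : 0 < p m * q m) : IsComplexEigenvalue L (√(p m * q m) : ℝ) := by
  refine (h.baseChange ℂ).hasEigenvalue_of_sq_eq (m := m) ?_ ?_
  · simpa using right_ne_zero_of_mul hpq.ne'
  · rw [← ofReal_pow, Real.sq_sqrt hpq.le]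
    simp

open scoped ComplexOrder in
theorem re_eq_zero_of_isComplexEigenvalue (h : IsPaired b (L : E →ₗ[ℝ] E) p q)
    (hpq : ∀ m, p m * q m ≤ 0) {μ : ℂ} (hμ : IsComplexEigenvalue L μ) : μ.re = 0 := by
  obtain ⟨m, hm⟩ := (h.baseChange ℂ).exists_sq_eq_of_hasEigenvalue hμ
  have hsq : μ ^ 2 = ((p m * q m : ℝ) : ℂ) := by simpa using hm
  exact Complex.sq_nonpos_iff.mp (hsq.trans_le (by exact_mod_cast hpq m))

theorem isLinearlyUnstable (h : IsPaired b (L : E →ₗ[ℝ] E) p q) {F : E → E} {x : E}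
    (hF : HasFDerivAt F L x) {m : ι} (hpq : 0 < p m * q m) : IsLinearlyUnstable F x :=
  ⟨L, hF, _, h.isComplexEigenvalue_sqrt hpq, by simpa using hpq⟩

variable [Finite ι]

theorem not_isFlowBoundedModulo (h : IsPaired b (L : E →ₗ[ℝ] E) p q) {m : ι} (hp : p m = 0)
    (hq : q m ≠ 0) {v : E} (hv : b.repr v (0, m) = 0) : ¬IsFlowBoundedModulo L v := by
  rintro ⟨K, hK⟩
  obtain ⟨M, hM, hrepr⟩ := exists_abs_basis_repr_le b (0, m)
  let η : ℝ → E := fun t => b (1, m) + t • q m • b (0, m)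
  have hη (t : ℝ) : HasDerivAt η (L (η t)) t := by
    refine (((hasDerivAt_id t).smul_const (q m • b (0, m))).const_add (b (1, m))).congr_deriv ?_
    have hzero : L (b (0, m)) = 0 := (h.apply_zero m).trans (by rw [hp, zero_smul])
    have hone : L (b (1, m)) = q m • b (0, m) := h.apply_one m
    simp [η, hzero, hone]
  obtain ⟨n, hn⟩ := exists_lt_nsmul (abs_pos.mpr hq) (M * (K * ‖η 0‖))
  obtain ⟨s, hs⟩ := hK η hη n n.cast_nonneg
  have hcoord : b.repr (η n - s • v) (0, m) = n • q m := by simp [η, hv]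
  have hle := (hrepr (η n - s • v)).trans (mul_le_mul_of_nonneg_left hs hM)
  rw [hcoord, abs_nsmul] at hle
  exact hle.not_gt hn

theorem exists_abs_repr_le_of_mul_neg (h : IsPaired b (L : E →ₗ[ℝ] E) p q) {m : ι}
    (hpq : p m * q m < 0) (k : Fin 2) :
    ∃ K, ∀ η : ℝ → E, (∀ t, HasDerivAt η (L (η t)) t) →
      ∀ t, |b.repr (η t) (k, m)| ≤ K * ‖η 0‖ := by
  obtain ⟨M₀, -, hM₀⟩ := exists_abs_basis_repr_le b (0, m)
  obtain ⟨M₁, -, hM₁⟩ := exists_abs_basis_repr_le b (1, m)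
  have hu {η : ℝ → E} (hη : ∀ t, HasDerivAt η (L (η t)) t) (t : ℝ) :=
    (hasDerivAt_basis_repr b (hη t) (0, m)).congr_deriv (h.repr_apply_zero (η t) m)
  have hw {η : ℝ → E} (hη : ∀ t, HasDerivAt η (L (η t)) t) (t : ℝ) :=
    (hasDerivAt_basis_repr b (hη t) (1, m)).congr_deriv (h.repr_apply_one (η t) m)
  fin_cases k
  · refine ⟨M₀ + √(-(q m / p m)) * M₁, fun η hη t => ?_⟩
    refine (abs_le_of_hasDerivAt_of_mul_neg hpq (hu hη) (hw hη) t).trans ?_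
    rw [add_mul, mul_assoc]
    gcongr <;> apply_assumption
  · refine ⟨M₁ + √(-(p m / q m)) * M₀, fun η hη t => ?_⟩
    refine (abs_le_of_hasDerivAt_of_mul_neg (mul_comm (p m) _ ▸ hpq) (hw hη) (hu hη) t).trans ?_
    rw [add_mul, mul_assoc]
    gcongr <;> apply_assumption

theorem exists_abs_repr_zero_le_of_eq_zero (h : IsPaired b (L : E →ₗ[ℝ] E) p q) {m : ι}
    (hq : q m = 0) :
    ∃ K, ∀ η : ℝ → E, (∀ t, HasDerivAt η (L (η t)) t) →
      ∀ t, |b.repr (η t) (0, m)| ≤ K * ‖η 0‖ := by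
  obtain ⟨M, -, hM⟩ := exists_abs_basis_repr_le b (0, m)
  refine ⟨M, fun η hη t => ?_⟩
  have hderiv (s : ℝ) : HasDerivAt (fun t => b.repr (η t) (0, m)) 0 s :=
    (hasDerivAt_basis_repr b (hη s) (0, m)).congr_deriv
      ((h.repr_apply_zero (η s) m).trans (by rw [hq, zero_mul]))
  have hconst : b.repr (η t) (0, m) = b.repr (η 0) (0, m) :=
    is_const_of_deriv_eq_zero (fun s => (hderiv s).differentiableAt) (fun s => (hderiv s).deriv) t 0
  exact hconst ▸ hM (η 0)

theorem isFlowBoundedModulo (h : IsPaired b (L : E →ₗ[ℝ] E) p q) {i : ι} (hi : q i = 0)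
    (hpq : ∀ m ≠ i, p m * q m < 0) {r : ℝ} (hr : r ≠ 0) :
    IsFlowBoundedModulo L (r • b (1, i)) := by
  refine isFlowBoundedModulo_of_repr_le b hr fun ⟨k, m⟩ hk => ?_
  rcases eq_or_ne m i with rfl | hm
  · obtain rfl : k = 0 := by
      contrapose! hk
      rw [Fin.eq_one_of_ne_zero k hk]
    exact h.exists_abs_repr_zero_le_of_eq_zero hi
  · exact h.exists_abs_repr_le_of_mul_neg (hpq m hm) k

theorem isLinearlyStable_iff (h : IsPaired b (L : E →ₗ[ℝ] E) p q) {F : E → E} {x : E}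
    (hF : HasFDerivAt F L x) {i : ι} (hi : q i = 0) (hq : ∀ m ≠ i, q m ≠ 0) {r : ℝ}
    (hr : r ≠ 0) : IsLinearlyStable F x (r • b (1, i)) ↔ ∀ m ≠ i, p m * q m < 0 := by
  constructor
  · rintro ⟨L', hL', hre, hbounded⟩ m hm
    obtain rfl := hF.unique hL'
    rcases lt_trichotomy (p m * q m) 0 with hneg | hzero | hpos
    · exact hneg
    · exact absurd hbounded (h.not_isFlowBoundedModulo
        ((mul_eq_zero.mp hzero).resolve_right (hq m hm)) (hq m hm) (by simp))
    · exact absurd (hre _ (h.isComplexEigenvalue_sqrt hpos)) (Real.sqrt_pos.mpr hpos).ne'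
  · intro hpq
    refine ⟨L, hF, fun μ => h.re_eq_zero_of_isComplexEigenvalue fun m => ?_,
      h.isFlowBoundedModulo hi hpq hr⟩
    rcases eq_or_ne m i with rfl | hm
    · rw [hi, mul_zero]
    · exact (hpq m hm).le

end Flow

end IsPaired

end PairedOperators

section Stability

variable {N : ℕ} {f : ℝ → ℝ} {c R : ℝ}

theorem charpoly_eq_prod_of_apply_basis {ι 𝕜 E : Type*} [Fintype ι] [CommRing 𝕜] [AddCommGroup E]
    [Module 𝕜 E] [Module.Free 𝕜 E] [Module.Finite 𝕜 E] (b : Module.Basis ι 𝕜 E) {T : E →ₗ[𝕜] E}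
    {d : ι → 𝕜} (hT : ∀ i, T (b i) = d i • b i) : T.charpoly = ∏ i, (X - C (d i)) := by
  classical
  have hdiag : LinearMap.toMatrix b b T = Matrix.diagonal d := by
    ext i j
    rw [LinearMap.toMatrix_apply, hT, map_smul, Finsupp.smul_apply, b.repr_self, smul_eq_mul,
      Matrix.diagonal_apply, Finsupp.single_apply]
    split_ifs <;> simp_all
  rw [← LinearMap.charpoly_toMatrix T b, hdiag, Matrix.charpoly_diagonal]

theorem exists_hasFDerivAt_aggregationField_charpoly [NeZero N] (c : ℝ) (hR : 0 < R)
    (hf : DifferentiableAt ℝ f R) :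
    ∃ A : (Fin N → ℂ) →L[ℝ] (Fin N → ℂ),
      HasFDerivAt (aggregationField f c (ringFrequency N f c R)) A (ringPolygon N R) ∧
      (A : (Fin N → ℂ) →ₗ[ℝ] (Fin N → ℂ)).charpoly = ∏ m ∈ Finset.range N,
        (X - C (lambdaPlus N f c R m)) * (X - C (lambdaMinus N c R m)) := by
  obtain ⟨A, hA, hradial, htangential⟩ :=
    exists_hasFDerivAt_aggregationField_radialMode (N := N) c hR hf
  let b := polygonBasis (isPrimitiveRoot_ringRoot (NeZero.ne N))
  have hAb (k : Fin 2 × Fin N) : A (b k) =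
      (![lambdaPlus N f c R k.2, lambdaMinus N c R k.2] k.1) • b k := by
    obtain ⟨i, m⟩ := k
    fin_cases i
    · simpa [b, polygonBasis_zero] using hradial m
    · simpa [b, polygonBasis_one] using htangential m
  refine ⟨A, hA, ?_⟩
  rw [charpoly_eq_prod_of_apply_basis b hAb, Fintype.prod_prod_type, Fin.prod_univ_two,
    ← Finset.prod_mul_distrib, Finset.prod_range]
  rfl

theorem corotatingField_eq (f : ℝ → ℝ) (c ω : ℝ) :
    corotatingField (N := N) f c ω = I • aggregationField f c ω := by
  funext x j
  simp only [corotatingField, vortexField, aggregationField, Pi.smul_apply, smul_eq_mul]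
  push_cast
  ring

theorem vortexField_smul (f : ℝ → ℝ) (c : ℝ) {u : ℂ} (hu : ‖u‖ = 1) (x : Fin N → ℂ) :
    vortexField f c (u • x) = u • vortexField f c x := by
  funext j
  simp only [vortexField, Pi.smul_apply, smul_eq_mul, ← mul_sub, norm_mul, hu, one_mul,
    mul_div_assoc, ← Finset.mul_sum]
  ring

theorem hasDerivAt_exp_smul_of_corotatingField_eq_zero {ω : ℝ} {x : Fin N → ℂ}
    (hx : corotatingField f c ω x = 0) (t : ℝ) :
    HasDerivAt (fun t : ℝ => exp (I * ω * t) • x) (vortexField f c (exp (I * ω * t) • x)) t := by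
  have hunit : ‖exp (I * ω * t)‖ = 1 := by
    rw [mul_assoc, mul_comm, ← ofReal_mul, norm_exp_ofReal_mul_I]
  have hfield : vortexField f c x = (I * ω) • x :=
    funext fun j => sub_eq_zero.mp (congrFun hx j)
  have hexp : HasDerivAt (fun t : ℝ => exp (I * ω * t)) (exp (I * ω * t) * (I * ω)) t := by
    simpa using ((ofRealCLM.hasDerivAt (x := t)).const_mul (I * (ω : ℂ))).cexp
  rw [vortexField_smul f c hunit, hfield, smul_smul]
  exact hexp.smul_const x

theorem hasDerivAt_ringSolution (f : ℝ → ℝ) (c : ℝ) (hR : 0 < R) (t : ℝ) :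
    HasDerivAt (ringSolution N R (ringFrequency N f c R))
      (vortexField f c (ringSolution N R (ringFrequency N f c R) t)) t :=
  hasDerivAt_exp_smul_of_corotatingField_eq_zero
    (by rw [corotatingField_eq, Pi.smul_apply, aggregationField_ringPolygon f c hR, smul_zero]) t

theorem exists_hasFDerivAt_corotatingField_isPaired [NeZero N] (c : ℝ) (hR : 0 < R)
    (hf : DifferentiableAt ℝ f R) :
    ∃ L : (Fin N → ℂ) →L[ℝ] (Fin N → ℂ),
      HasFDerivAt (corotatingField f c (ringFrequency N f c R)) L (ringPolygon N R) ∧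
      IsPaired (polygonBasis (isPrimitiveRoot_ringRoot (NeZero.ne N)))
        (L : (Fin N → ℂ) →ₗ[ℝ] (Fin N → ℂ)) (fun m => lambdaPlus N f c R m)
        (fun m => -lambdaMinus N c R m) := by
  obtain ⟨A, hA, hradial, htangential⟩ :=
    exists_hasFDerivAt_aggregationField_radialMode (N := N) c hR hf
  refine ⟨I • A, corotatingField_eq (N := N) f c _ ▸ hA.const_smul I, fun m => ?_, fun m => ?_⟩
  · rw [polygonBasis_zero, polygonBasis_one, ContinuousLinearMap.coe_coe,
      smul_apply, hradial, smul_comm]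
  · rw [polygonBasis_zero, polygonBasis_one, ContinuousLinearMap.coe_coe,
      smul_apply, htangential, smul_comm, smul_smul I, I_mul_I, neg_one_smul,
      smul_neg, neg_smul]

theorem I_smul_ringPolygon [NeZero N] (R : ℝ) :
    I • ringPolygon N R = R • polygonBasis (isPrimitiveRoot_ringRoot (NeZero.ne N)) (1, 0) := by
  rw [polygonBasis_one, smul_comm]
  congr 1
  funext j
  rw [ringPolygon_apply, Pi.smul_apply, radialMode, hartleyMode_zero, ofReal_one, mul_one,
    real_smul]

theorem lambdaMinus_zero (N : ℕ) (c R : ℝ) : lambdaMinus N c R 0 = 0 := by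
  simp [lambdaMinus]

theorem lambdaMinus_neg (hc : 0 < c) (hR : 0 < R) {m : ℕ} (hm : 0 < m) (hmN : m < N) :
    lambdaMinus N c R m < 0 := by
  have hm' : (1 : ℝ) ≤ m := by exact_mod_cast hm
  have hmN' : (m : ℝ) + 1 ≤ N := by exact_mod_cast hmN
  refine mul_neg_of_pos_of_neg (by positivity) ?_
  nlinarith [mul_nonneg (sub_nonneg.mpr hm') (sub_nonneg.mpr hmN')]

theorem lambdaPlus_le_lambdaPlus_half (f : ℝ → ℝ) (hc : 0 ≤ c) (m : ℕ) :
    lambdaPlus N f c R m ≤ lambdaPlus N f c R (N / 2) := by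
  have hdiff : lambdaPlus N f c R (N / 2) - lambdaPlus N f c R m =
      c / (2 * R ^ 2) * (((m : ℝ) - (N / 2 : ℕ)) * (m + (N / 2 : ℕ) - N)) := by
    simp only [lambdaPlus]
    ring
  rw [← sub_nonneg, hdiff]
  refine mul_nonneg (by positivity) ?_
  rcases le_or_gt m (N / 2) with hm | hm
  · have hmN : (m : ℝ) + (N / 2 : ℕ) ≤ N := by exact_mod_cast (by omega : m + N / 2 ≤ N)
    exact mul_nonneg_of_nonpos_of_nonpos (sub_nonpos.mpr (by exact_mod_cast hm))
      (sub_nonpos.mpr hmN)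
  · have hmN : (N : ℝ) ≤ m + (N / 2 : ℕ) := by exact_mod_cast (by omega : N ≤ m + N / 2)
    exact mul_nonneg (sub_nonneg.mpr (by exact_mod_cast hm.le)) (sub_nonneg.mpr hmN)

theorem lambdaPlus_half_of_odd (f : ℝ → ℝ) (c R : ℝ) (hN : Odd N) :
    lambdaPlus N f c R (N / 2) =
      deriv f R * R + c / (8 * R ^ 2) * (((N : ℝ) - 1) * ((N : ℝ) - 7)) := by
  obtain ⟨k, rfl⟩ := hN
  rw [(by omega : (2 * k + 1) / 2 = k), lambdaPlus]
  push_cast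
  ring

theorem lambdaPlus_half_of_even (f : ℝ → ℝ) (c R : ℝ) (hN : Even N) :
    lambdaPlus N f c R (N / 2) =
      deriv f R * R + c / (8 * R ^ 2) * ((N : ℝ) ^ 2 - 8 * (N : ℝ) + 8) := by
  obtain ⟨k, rfl⟩ := hN
  rw [(by omega : (k + k) / 2 = k), lambdaPlus]
  push_cast
  ring

theorem ringIsStable_iff_forall [NeZero N] (hc : 0 < c) (hR : 0 < R)
    (hf : DifferentiableAt ℝ f R) :
    RingIsStable N f c R ↔ ∀ m : Fin N, m ≠ 0 → lambdaPlus N f c R m < 0 := by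
  obtain ⟨L, hL, hpaired⟩ := exists_hasFDerivAt_corotatingField_isPaired (N := N) c hR hf
  have hminus (m : Fin N) (hm : m ≠ 0) : 0 < -lambdaMinus N c R m :=
    neg_pos.mpr (lambdaMinus_neg hc hR (Fin.pos_iff_ne_zero.mpr hm) m.2)
  rw [RingIsStable, I_smul_ringPolygon, hpaired.isLinearlyStable_iff hL
    (by simpa using lambdaMinus_zero N c R) (fun m hm => (hminus m hm).ne') hR.ne']
  exact forall₂_congr fun m hm => ⟨fun h => neg_of_mul_neg_left h (hminus m hm).le,
    fun h => mul_neg_of_neg_of_pos h (hminus m hm)⟩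

theorem ringIsStable_iff (hN : 2 ≤ N) (hc : 0 < c) (hR : 0 < R) (hf : DifferentiableAt ℝ f R) :
    RingIsStable N f c R ↔ lambdaPlus N f c R (N / 2) < 0 := by
  have : NeZero N := ⟨by omega⟩
  rw [ringIsStable_iff_forall hc hR hf]
  refine ⟨fun h => h ⟨N / 2, by omega⟩ (Fin.val_ne_zero_iff.mp (by simp; omega)),
    fun h m _ => (lambdaPlus_le_lambdaPlus_half f hc.le m).trans_lt h⟩

theorem ringIsUnstable_of_lambdaPlus_pos (hc : 0 < c) (hR : 0 < R) (hf : DifferentiableAt ℝ f R)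
    {m : ℕ} (hm : 0 < m) (hmN : m < N) (hpos : 0 < lambdaPlus N f c R m) :
    RingIsUnstable N f c R := by
  have : NeZero N := ⟨by omega⟩
  obtain ⟨L, hL, hpaired⟩ := exists_hasFDerivAt_corotatingField_isPaired (N := N) c hR hf
  exact hpaired.isLinearlyUnstable hL (m := ⟨m, hmN⟩)
    (mul_pos hpos (neg_pos.mpr (lambdaMinus_neg hc hR hm hmN)))

theorem ringIsUnstable_of_deriv_nonneg (hN : 7 ≤ N) (hc : 0 < c) (hR : 0 < R)
    (hf : DifferentiableAt ℝ f R) (hderiv : 0 ≤ deriv f R) (h : 8 ≤ N ∨ 0 < deriv f R) :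
    RingIsUnstable N f c R := by
  refine ringIsUnstable_of_lambdaPlus_pos hc hR hf (m := 3) (by omega) (by omega) ?_
  have hthree : lambdaPlus N f c R 3 = deriv f R * R + c / (2 * R ^ 2) * (N - 7) := by
    rw [lambdaPlus]
    push_cast
    ring
  have hN' : (0 : ℝ) ≤ N - 7 := sub_nonneg.mpr (by exact_mod_cast hN)
  rw [hthree]
  rcases h with h8 | hpos
  · have h8' : (0 : ℝ) < N - 7 := sub_pos.mpr (by exact_mod_cast h8)
    positivity
  · positivity

end Stability

theorem subset_closure_deriv_pos {f : ℝ → ℝ} {S : Set ℝ} (hS : IsOpen S)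
    (hf : DifferentiableOn ℝ f S) (hmono : StrictMonoOn f S) :
    S ⊆ closure {x ∈ S | 0 < deriv f x} := by
  refine fun x hx => mem_closure_iff.mpr fun V hV hxV => ?_
  obtain ⟨y, hxy, hsub⟩ := mem_nhdsGE_iff_exists_Icc_subset.mp
    (mem_nhdsWithin_of_mem_nhds ((hV.inter hS).mem_nhds ⟨hxV, hx⟩))
  have hsubS : Set.Icc x y ⊆ S := hsub.trans Set.inter_subset_right
  obtain ⟨z, hz, hslope⟩ := exists_deriv_eq_slope f hxy (hf.continuousOn.mono hsubS)
    (hf.mono (Set.Ioo_subset_Icc_self.trans hsubS))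
  have hzVS := hsub (Set.Ioo_subset_Icc_self hz)
  have hlt : f x < f y := hmono hx (hsubS (Set.right_mem_Icc.mpr hxy.le)) hxy
  exact ⟨z, hzVS.1, hzVS.2, hslope ▸ div_pos (sub_pos.mpr hlt) (sub_pos.mpr hxy)⟩

theorem theorem2 (N : ℕ) (hN : 2 ≤ N) (c : ℝ) (hc : 0 < c) :
    (∀ (f : ℝ → ℝ) (R : ℝ), 0 < R → DifferentiableAt ℝ f R →
      -- the ring is a solution of the vortex system
      (∀ t : ℝ, HasDerivAt (ringSolution N R (ringFrequency N f c R))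
        (vortexField f c (ringSolution N R (ringFrequency N f c R) t)) t) ∧
      -- eigenvalues, with multiplicity, of the linearized aggregation system at the ring
      (∃ A : (Fin N → ℂ) →L[ℝ] (Fin N → ℂ),
        aggregationField f c (ringFrequency N f c R) (ringPolygon N R) = 0 ∧
        HasFDerivAt (aggregationField f c (ringFrequency N f c R)) A (ringPolygon N R) ∧
        (A : (Fin N → ℂ) →ₗ[ℝ] (Fin N → ℂ)).charpoly =
          ∏ m ∈ Finset.range N,
            (Polynomial.X - Polynomial.C (lambdaPlus N f c R m)) *
              (Polynomial.X - Polynomial.C (lambdaMinus N c R m))) ∧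
      (Odd N →
        (RingIsStable N f c R ↔
          deriv f R * R + c / (8 * R ^ 2) * (((N : ℝ) - 1) * ((N : ℝ) - 7)) < 0) ∧
        (0 < deriv f R * R + c / (8 * R ^ 2) * (((N : ℝ) - 1) * ((N : ℝ) - 7)) →
          RingIsUnstable N f c R)) ∧
      (Even N →
        (RingIsStable N f c R ↔
          deriv f R * R + c / (8 * R ^ 2) * ((N : ℝ) ^ 2 - 8 * (N : ℝ) + 8) < 0) ∧
        (0 < deriv f R * R + c / (8 * R ^ 2) * ((N : ℝ) ^ 2 - 8 * (N : ℝ) + 8) →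
          RingIsUnstable N f c R))) ∧
    -- generic instability for at least seven vortices and increasing precession frequency
    (7 ≤ N → ∀ (f : ℝ → ℝ) (S : Set ℝ), IsOpen S → S ⊆ Set.Ioi 0 →
      ContDiffOn ℝ 1 f S → StrictMonoOn f S →
      (∀ R ∈ S, (8 ≤ N ∨ 0 < deriv f R) → RingIsUnstable N f c R) ∧
      ∃ U : Set ℝ, IsOpen U ∧ U ⊆ S ∧ S ⊆ closure U ∧ ∀ R ∈ U, RingIsUnstable N f c R) := by
  have : NeZero N := ⟨by omega⟩
  refine ⟨fun f R hR hf => ⟨hasDerivAt_ringSolution f c hR, ?_, fun hodd => ?_, fun heven => ?_⟩,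
    fun hN7 f S hS hSpos hf hmono => ?_⟩
  · obtain ⟨A, hA, hcharpoly⟩ := exists_hasFDerivAt_aggregationField_charpoly (N := N) c hR hf
    exact ⟨A, aggregationField_ringPolygon f c hR, hA, hcharpoly⟩
  · rw [← lambdaPlus_half_of_odd f c R hodd]
    exact ⟨ringIsStable_iff hN hc hR hf,
      ringIsUnstable_of_lambdaPlus_pos hc hR hf (by omega) (by omega)⟩
  · rw [← lambdaPlus_half_of_even f c R heven]
    exact ⟨ringIsStable_iff hN hc hR hf,
      ringIsUnstable_of_lambdaPlus_pos hc hR hf (by omega) (by omega)⟩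
  · have hdiff : DifferentiableOn ℝ f S := hf.differentiableOn one_ne_zero
    have hunstable (R) (hR : R ∈ S) (h : 8 ≤ N ∨ 0 < deriv f R) : RingIsUnstable N f c R := by
      refine ringIsUnstable_of_deriv_nonneg hN7 hc (hSpos hR)
        (hdiff.differentiableAt (hS.mem_nhds hR)) ?_ h
      rw [← derivWithin_of_isOpen hS hR]
      exact hmono.monotoneOn.derivWithin_nonneg
    exact ⟨hunstable, {R ∈ S | 0 < deriv f R},
      (hf.continuousOn_deriv_of_isOpen hS le_rfl).isOpen_inter_preimage hS isOpen_Ioi,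
      Set.sep_subset _ _, subset_closure_deriv_pos hS hdiff hmono,
      fun R hR => hunstable R hR.1 (Or.inr hR.2)⟩
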